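/- Let $\alpha,\beta,\gamma,\mu,\nu,\kappa,D$ be real constants and consider the partial differential equation $$u_{tt} = (\kappa u+\gamma u^2)_{xx} + \nu u\,u_{xxxx} + \mu u_{xxtt} + \alpha u_x u_{xxx} + \beta u_{xx}^2. \tag{1}$$ If $H$ is four times continuously differentiable near $x-Dt$, then $u(x,t)=H(x-Dt)$ satisfies (1) at $(x,t)$ if and only if $H$ satisfies, at the point $x-Dt$, the fourth-order ordinary differential equation $$(\nu H+\mu D^2)H^{(4)} + \alpha H'H''' + \beta H''^2 + (2\gamma H+\kappa-D^2)H'' + 2\gamma H'^2 = 0. \tag{2}$$ Write $x$ for the independent and $y=H$ for the dependent variable of (2). Equation (2) is called linearizable near a point $(x_0,y_0)$ if there are a smooth, injective change of variables $t=\varphi(x,y)$, $w=\psi(x,y)$ with nowhere vanishing Jacobian on an open neighbourhood $U$ of $(x_0,y_0)$ (a point transformation), and smooth functions $a,b$ on $\varphi(U)$, such that the change of variables transforms (2) into a linear equation $$w^{(4)} + a(t)\,w' + b(t)\,w = 0;$$ that is, for every $C^4$ function $y(x)$ with graph through $U$ along which $\frac{d}{dx}\varphi(x,y(x))\neq 0$,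 $y$ satisfies (2) at $x$ if and only if the transformed function $w(t)$, given by $w(\varphi(x,y(x)))=\psi(x,y(x))$, satisfies the linear equation at $t=\varphi(x,y(x))$. Let $(x_0,y_0)$ be any point at which (2) is genuinely of fourth order, i.e. $\nu y_0+\mu D^2\neq 0$ (for $\nu=0$ this says $\mu D^2\ne0$). Then: - if $\nu=0$, equation (2) is linearizable near $(x_0,y_0)$ if and only if $\alpha=\beta=\gamma=0$; - if $\nu\neq0$ and $\gamma=0$, equation (2) is linearizable near $(x_0,y_0)$ if and only if either $\beta=0$, $\alpha=0$, $\kappa=D^2$, or $\beta=3\nu$, $\alpha=4\nu$, $\kappa=D^2$; - if $\nu\neq0$ and $\gamma\neq0$, equation (2) is linearizable near $(x_0,y_0)$ if and only if $\alpha=4\nu$, $\beta=3\nu$ and $\kappa=\dfrac{(2\gamma\mu+\nu)D^2}{\nu}$. In particular the conditions do not depend on the point $(x_0,y_0)$. -/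

import Mathlib

open scoped ContDiff Topology

/-- A scalar ordinary differential equation of order at most four, given by a function `F` of
`(x, y, y', y'', y''', y'''')`; the equation is `F = 0`. -/
abbrev ODE4 := ℝ → ℝ → ℝ → ℝ → ℝ → ℝ → ℝ

/-- The function `y` satisfies the equation `F = 0` at the point `x`. -/
def ODE4.HoldsAt (F : ODE4) (y : ℝ → ℝ) (x : ℝ) : Prop :=
  F x (y x) (deriv y x) (iteratedDeriv 2 y x) (iteratedDeriv 3 y x) (iteratedDeriv 4 y x) = 0

/-- The linear equation `u'''' + a(t) u' + b(t) u = 0`. -/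
def linearODE (a b : ℝ → ℝ) : ODE4 :=
  fun t u u₁ _ _ u₄ => u₄ + a t * u₁ + b t * u

/-- The map `(x, y) ↦ (φ(x, y), ψ(x, y))` is a point transformation on `U`: it is smooth,
injective and has nonvanishing Jacobian determinant `φ_x ψ_y - φ_y ψ_x` on the open set `U`. -/
structure IsPointTransformation (φ ψ : ℝ × ℝ → ℝ) (U : Set (ℝ × ℝ)) : Prop where
  isOpen : IsOpen U
  smooth_fst : ContDiffOn ℝ ∞ φ U
  smooth_snd : ContDiffOn ℝ ∞ ψ U
  injOn : Set.InjOn (fun p => (φ p, ψ p)) U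
  jacobian_ne_zero : ∀ p ∈ U,
    fderiv ℝ φ p (1, 0) * fderiv ℝ ψ p (0, 1) - fderiv ℝ φ p (0, 1) * fderiv ℝ ψ p (1, 0) ≠ 0

/-- The change of variables `t = φ(x, y)`, `u = ψ(x, y)` on `U` turns the equation `F = 0` for
`y(x)` into the equation `G = 0` for `u(t)`. Here a function `y(x)` with graph through `U` along
which `dt/dx ≠ 0` is transformed into the function `u(t)` (a well-defined germ) with
`u(φ(s, y(s))) = ψ(s, y(s))`, and `y` has to satisfy the first equation at `x` exactly when `u`
satisfies the second one at `t = φ(x, y(x))`. -/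
def TransformsInto (φ ψ : ℝ × ℝ → ℝ) (U : Set (ℝ × ℝ)) (F G : ODE4) : Prop :=
  ∀ (y u : ℝ → ℝ) (x : ℝ), (x, y x) ∈ U →
    ContDiffAt ℝ 4 y x →
    deriv (fun s => φ (s, y s)) x ≠ 0 →
    ContDiffAt ℝ 4 u (φ (x, y x)) →
    (∀ᶠ s in 𝓝 x, u (φ (s, y s)) = ψ (s, y s)) →
    (F.HoldsAt y x ↔ G.HoldsAt u (φ (x, y x)))

/-- The equation `F = 0` is linearizable by a point transformation near the point `(x₀, y₀)` of the
plane of independent and dependent variables. -/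
def LinearizableAt (F : ODE4) (x₀ y₀ : ℝ) : Prop :=
  ∃ (U : Set (ℝ × ℝ)) (φ ψ : ℝ × ℝ → ℝ) (a b : ℝ → ℝ),
    (x₀, y₀) ∈ U ∧ IsPointTransformation φ ψ U ∧
    ContDiffOn ℝ ∞ a (φ '' U) ∧ ContDiffOn ℝ ∞ b (φ '' U) ∧
    TransformsInto φ ψ U F (linearODE a b)

/-- The function `u(x, t)` satisfies, at the point `(x, t)`, the partial differential equation
`u_tt = (κ u + γ u²)_xx + ν u u_xxxx + μ u_xxtt + α u_x u_xxx + β u_xx²`. -/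
def PDEHoldsAt (α β γ μ ν κ : ℝ) (u : ℝ → ℝ → ℝ) (x t : ℝ) : Prop :=
  iteratedDeriv 2 (fun s => u x s) t =
    iteratedDeriv 2 (fun ξ => κ * u ξ t + γ * u ξ t ^ 2) x
      + ν * u x t * iteratedDeriv 4 (fun ξ => u ξ t) x
      + μ * iteratedDeriv 2 (fun s => iteratedDeriv 2 (fun ξ => u ξ s) x) t
      + α * deriv (fun ξ => u ξ t) x * iteratedDeriv 3 (fun ξ => u ξ t) x
      + β * iteratedDeriv 2 (fun ξ => u ξ t) x ^ 2

/-- The travelling-wave equation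
`(ν H + μ D²) H'''' + α H' H''' + β H''² + (2 γ H + κ - D²) H'' + 2 γ H'² = 0`. -/
def waveODE (α β γ μ ν κ D : ℝ) : ODE4 :=
  fun _ H H₁ H₂ H₃ H₄ =>
    (ν * H + μ * D ^ 2) * H₄ + α * H₁ * H₃ + β * H₂ ^ 2
      + (2 * γ * H + κ - D ^ 2) * H₂ + 2 * γ * H₁ ^ 2

/-! Necessity. A point transformation acts on fourth-order jets (`TransformsInto.exists_jet`).
Eliminating the derivatives of the new variable and solving the equation for y'''' leaves one
identity in free y', y'', y''' (`TransformsInto.jet_identity`). Its y'' y''' coefficient forces φ_y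
= 0. The identity is then polynomial, and its coefficients relate φ, ψ and the constants
(`linearization_constraints`). Put f = ν y + μ D² and g = 2γ y + κ - D². The relations give α = 4k,
β = 3k and f ψ_yy = k ψ_y; comparing them with their derivatives gives k (ν - k) = 0, k g = 2γ f and
(k - ν) g = 0 (`LinearizableAt.exists_parameter`), which settles all three cases.

Sufficiency. In the listed cases the equation is f (H'''' + 10 q H'') = 0 (k = 0) or w'''' + 10 q
w'' = 0 with w = μ D² H + ν H² / 2 (k = ν). The operator (∂² + q)(∂² + 9q) = ∂⁴ + 10 q ∂² + 9 q² is
the symmetric cube of ∂² + q. So if C and S solve s'' + q s = 0, the substitution t = S / C, w = C³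
u turns it into a multiple of u'''', and the remaining -9 q² w contributes only to the coefficient b
(`HasJets.laguerreForsyth`). -/

/-! ### Fourth-order jets of functions of one variable. -/

/-- Near `x`, the functions `f₁, f₂, f₃, f₄` are the successive derivatives of `f`. -/
structure HasJets (f f₁ f₂ f₃ f₄ : ℝ → ℝ) (x : ℝ) : Prop where
  one : ∀ᶠ s in 𝓝 x, HasDerivAt f (f₁ s) s
  two : ∀ᶠ s in 𝓝 x, HasDerivAt f₁ (f₂ s) s
  three : ∀ᶠ s in 𝓝 x, HasDerivAt f₂ (f₃ s) s
  four : ∀ᶠ s in 𝓝 x, HasDerivAt f₃ (f₄ s) s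

theorem iteratedDeriv_succ_eventuallyEq {f g g' : ℝ → ℝ} {x : ℝ} {n : ℕ}
    (h : iteratedDeriv n f =ᶠ[𝓝 x] g) (h' : ∀ᶠ s in 𝓝 x, HasDerivAt g (g' s) s) :
    iteratedDeriv (n + 1) f =ᶠ[𝓝 x] g' := by
  filter_upwards [h.eventuallyEq_nhds, h'] with s hs hs'
  rw [iteratedDeriv_succ, hs.deriv_eq, hs'.deriv]

namespace HasJets

variable {f f₁ f₂ f₃ f₄ g g₁ g₂ g₃ g₄ : ℝ → ℝ} {x : ℝ}

theorem iteratedDeriv_eventuallyEq (h : HasJets f f₁ f₂ f₃ f₄ x) :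
    iteratedDeriv 1 f =ᶠ[𝓝 x] f₁ ∧ iteratedDeriv 2 f =ᶠ[𝓝 x] f₂ ∧
      iteratedDeriv 3 f =ᶠ[𝓝 x] f₃ ∧ iteratedDeriv 4 f =ᶠ[𝓝 x] f₄ := by
  have e0 : iteratedDeriv 0 f =ᶠ[𝓝 x] f := by rw [iteratedDeriv_zero]
  have e1 := iteratedDeriv_succ_eventuallyEq e0 h.one
  have e2 := iteratedDeriv_succ_eventuallyEq e1 h.two
  have e3 := iteratedDeriv_succ_eventuallyEq e2 h.three
  exact ⟨e1, e2, e3, iteratedDeriv_succ_eventuallyEq e3 h.four⟩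

theorem deriv_eq (h : HasJets f f₁ f₂ f₃ f₄ x) : deriv f x = f₁ x := h.one.self_of_nhds.deriv

theorem iteratedDeriv_two (h : HasJets f f₁ f₂ f₃ f₄ x) : iteratedDeriv 2 f x = f₂ x :=
  h.iteratedDeriv_eventuallyEq.2.1.self_of_nhds

theorem iteratedDeriv_three (h : HasJets f f₁ f₂ f₃ f₄ x) : iteratedDeriv 3 f x = f₃ x :=
  h.iteratedDeriv_eventuallyEq.2.2.1.self_of_nhds

theorem iteratedDeriv_four (h : HasJets f f₁ f₂ f₃ f₄ x) : iteratedDeriv 4 f x = f₄ x :=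
  h.iteratedDeriv_eventuallyEq.2.2.2.self_of_nhds

theorem congr (h : HasJets f f₁ f₂ f₃ f₄ x) (e : g =ᶠ[𝓝 x] f) : HasJets g f₁ f₂ f₃ f₄ x where
  one := by
    filter_upwards [h.one, e.eventuallyEq_nhds] with s hs es using hs.congr_of_eventuallyEq es
  two := h.two
  three := h.three
  four := h.four

theorem unique (h : HasJets f f₁ f₂ f₃ f₄ x) (h' : HasJets f g₁ g₂ g₃ g₄ x) :
    f₁ x = g₁ x ∧ f₂ x = g₂ x ∧ f₃ x = g₃ x ∧ f₄ x = g₄ x :=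
  ⟨h.deriv_eq ▸ h'.deriv_eq, h.iteratedDeriv_two ▸ h'.iteratedDeriv_two,
    h.iteratedDeriv_three ▸ h'.iteratedDeriv_three, h.iteratedDeriv_four ▸ h'.iteratedDeriv_four⟩

theorem holdsAt_iff (h : HasJets f f₁ f₂ f₃ f₄ x) (F : ODE4) :
    F.HoldsAt f x ↔ F x (f x) (f₁ x) (f₂ x) (f₃ x) (f₄ x) = 0 := by
  rw [ODE4.HoldsAt, h.deriv_eq, h.iteratedDeriv_two, h.iteratedDeriv_three, h.iteratedDeriv_four]

/-- The chain rule for derivatives up to order four. -/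
theorem comp (hg : HasJets g g₁ g₂ g₃ g₄ (f x)) (hf : HasJets f f₁ f₂ f₃ f₄ x) :
    HasJets (fun s => g (f s)) (fun s => g₁ (f s) * f₁ s)
      (fun s => g₂ (f s) * f₁ s ^ 2 + g₁ (f s) * f₂ s)
      (fun s => g₃ (f s) * f₁ s ^ 3 + 3 * g₂ (f s) * f₁ s * f₂ s + g₁ (f s) * f₃ s)
      (fun s => g₄ (f s) * f₁ s ^ 4 + 6 * g₃ (f s) * f₁ s ^ 2 * f₂ s
        + g₂ (f s) * (3 * f₂ s ^ 2 + 4 * f₁ s * f₃ s) + g₁ (f s) * f₄ s) x := by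
  have hc : Filter.Tendsto f (𝓝 x) (𝓝 (f x)) := hf.one.self_of_nhds.continuousAt
  have c1 := hc.eventually hg.one
  have c2 := hc.eventually hg.two
  have c3 := hc.eventually hg.three
  have c4 := hc.eventually hg.four
  constructor
  · filter_upwards [c1, hf.one] with s a b using a.comp s b
  · filter_upwards [c2, hf.one, hf.two] with s a b b'
    refine ((a.comp s b).mul b').congr_deriv ?_
    simp only [Function.comp_apply]; ring
  · filter_upwards [c2, c3, hf.one, hf.two, hf.three] with s a a' b b' b''
    refine (((a'.comp s b).mul (b'.pow 2)).add ((a.comp s b).mul b'')).congr_deriv ?_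
    simp only [Function.comp_apply, Pi.pow_apply]; push_cast; ring
  · filter_upwards [c2, c3, c4, hf.one, hf.two, hf.three, hf.four] with s a a' a'' b b' b'' b'''
    refine ((((a''.comp s b).mul (b'.pow 3)).add
      ((((a'.comp s b).const_mul 3).mul b').mul b'')).add ((a.comp s b).mul b''')).congr_deriv ?_
    simp only [Function.comp_apply, Pi.mul_apply, Pi.pow_apply]; push_cast; ring

end HasJets

theorem ContDiffAt.eventually_hasDerivAt_iteratedDeriv {f : ℝ → ℝ} {x : ℝ} {n k : ℕ}
    (hf : ContDiffAt ℝ n f x) (hk : k < n) :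
    ∀ᶠ s in 𝓝 x, HasDerivAt (iteratedDeriv k f) (iteratedDeriv (k + 1) f s) s := by
  filter_upwards [hf.eventually (by simp)] with s hs
  rw [iteratedDeriv_succ]
  refine DifferentiableAt.hasDerivAt ?_
  have h1 := hs.differentiableAt_iteratedFDeriv (m := k) (by exact_mod_cast hk)
  rw [iteratedDeriv_eq_equiv_comp]
  exact (LinearIsometryEquiv.differentiable _).differentiableAt.comp s h1

theorem ContDiffAt.hasJets {f : ℝ → ℝ} {x : ℝ} (hf : ContDiffAt ℝ 4 f x) :
    HasJets f (deriv f) (iteratedDeriv 2 f) (iteratedDeriv 3 f) (iteratedDeriv 4 f) x where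
  one := by simpa using hf.eventually_hasDerivAt_iteratedDeriv (n := 4) (k := 0) (by simp)
  two := by simpa using hf.eventually_hasDerivAt_iteratedDeriv (n := 4) (k := 1) (by simp)
  three := hf.eventually_hasDerivAt_iteratedDeriv (n := 4) (k := 2) (by simp)
  four := hf.eventually_hasDerivAt_iteratedDeriv (n := 4) (k := 3) (by simp)

/-! ### Travelling-wave reduction. -/

theorem waveODE_holdsAt_travelling_iff {α β γ μ ν κ D : ℝ} {H : ℝ → ℝ} {x t : ℝ}
    (hH : ContDiffAt ℝ 4 H (x - D * t)) :
    PDEHoldsAt α β γ μ ν κ (fun ξ s => H (ξ - D * s)) x t ↔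
      (waveODE α β γ μ ν κ D).HoldsAt H (x - D * t) := by
  have J := hH.hasJets
  have hx : HasJets (fun ξ => ξ - D * t) (fun _ => 1) (fun _ => 0) (fun _ => 0) (fun _ => 0) x :=
    ⟨.of_forall fun s => by simpa using (hasDerivAt_id s).sub_const (D * t),
      .of_forall fun s => hasDerivAt_const s _, .of_forall fun s => hasDerivAt_const s _,
      .of_forall fun s => hasDerivAt_const s _⟩
  have ht : HasJets (fun s => x - D * s) (fun _ => -D) (fun _ => 0) (fun _ => 0) (fun _ => 0) t :=
    ⟨.of_forall fun s => by simpa using ((hasDerivAt_id s).const_mul D).const_sub x,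
      .of_forall fun s => hasDerivAt_const s _, .of_forall fun s => hasDerivAt_const s _,
      .of_forall fun s => hasDerivAt_const s _⟩
  have Jx := HasJets.comp (g := H) (f := fun ξ => ξ - D * t) J hx
  have Jt := HasJets.comp (g := H) (f := fun s => x - D * s) J ht
  have hq (v : ℝ) : HasJets (fun v => κ * v + γ * v ^ 2) (fun v => κ + 2 * γ * v)
      (fun _ => 2 * γ) (fun _ => 0) (fun _ => 0) v :=
    ⟨.of_forall fun s => (((hasDerivAt_id s).const_mul κ).add
        (((hasDerivAt_id s).pow 2).const_mul γ)).congr_deriv (by simp; ring),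
      .of_forall fun s => (((hasDerivAt_id s).const_mul (2 * γ)).const_add κ).congr_deriv (by simp),
      .of_forall fun s => hasDerivAt_const s _, .of_forall fun s => hasDerivAt_const s _⟩
  have Jq := HasJets.comp (hq _) Jx
  have hD (s : ℝ) : iteratedDeriv 2 (fun ξ => H (ξ - D * s)) x = iteratedDeriv 2 H (x - D * s) :=
    congrFun (iteratedDeriv_comp_sub_const 2 H (D * s)) x
  -- Only two derivatives of H'' are available, so `HasJets.comp` does not apply to it and the chain
  -- rule is used twice by hand.
  have Jm : iteratedDeriv 2 (fun s => iteratedDeriv 2 H (x - D * s)) t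
      = iteratedDeriv 4 H (x - D * t) * D ^ 2 := by
    have hc : Filter.Tendsto (fun s => x - D * s) (𝓝 t) (𝓝 (x - D * t)) :=
      ht.one.self_of_nhds.continuousAt
    have e1 := iteratedDeriv_succ_eventuallyEq
      (f := fun s => iteratedDeriv 2 H (x - D * s)) (n := 0) (by rw [iteratedDeriv_zero])
      (by filter_upwards [hc.eventually J.three, ht.one] with s a b using a.comp s b)
    have e2 := iteratedDeriv_succ_eventuallyEq e1
      (by filter_upwards [hc.eventually J.four, ht.one] with s a b
          using (a.comp s b).mul_const (-D))
    rw [e2.self_of_nhds]; ring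
  simp only [PDEHoldsAt, ODE4.HoldsAt, waveODE]
  rw [Jq.iteratedDeriv_two, Jx.iteratedDeriv_four, Jx.iteratedDeriv_three, Jx.iteratedDeriv_two,
    Jx.deriv_eq, Jt.iteratedDeriv_two]
  simp only [hD, Jm]
  constructor <;> intro h <;> linear_combination -h

/-! ### Mixed partials and total derivatives along graphs. -/

/-- The mixed partial derivative `∂ₓⁱ ∂ᵧʲ g` of a function of two real variables. -/
noncomputable def mixedPartial (g : ℝ × ℝ → ℝ) (i j : ℕ) : ℝ × ℝ → ℝ :=
  (fun h p => fderiv ℝ h p (1, 0))^[i] ((fun h p => fderiv ℝ h p (0, 1))^[j] g)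

section MixedPartial

variable {g : ℝ × ℝ → ℝ} {U : Set (ℝ × ℝ)}

theorem mixedPartial_succ_left (g : ℝ × ℝ → ℝ) (i j : ℕ) :
    mixedPartial g (i + 1) j = fun p => fderiv ℝ (mixedPartial g i j) p (1, 0) :=
  Function.iterate_succ_apply' _ _ _

theorem contDiffOn_fderiv_apply (hU : IsOpen U) (hg : ContDiffOn ℝ ∞ g U) (v : ℝ × ℝ) :
    ContDiffOn ℝ ∞ (fun p => fderiv ℝ g p v) U :=
  (hg.fderiv_of_isOpen hU (by simp)).clm_apply contDiffOn_const

theorem contDiffOn_mixedPartial (hU : IsOpen U) (hg : ContDiffOn ℝ ∞ g U) (i j : ℕ) :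
    ContDiffOn ℝ ∞ (mixedPartial g i j) U := by
  induction i with
  | zero =>
    induction j with
    | zero => exact hg
    | succ j ih =>
      have : mixedPartial g 0 (j + 1) = fun p => fderiv ℝ (mixedPartial g 0 j) p (0, 1) :=
        Function.iterate_succ_apply' _ _ _
      exact this ▸ contDiffOn_fderiv_apply hU ih _
  | succ i ih => exact mixedPartial_succ_left g i j ▸ contDiffOn_fderiv_apply hU ih _

theorem fderiv_fderiv_apply_comm (hU : IsOpen U) (hg : ContDiffOn ℝ ∞ g U) {p : ℝ × ℝ}
    (hp : p ∈ U) (v w : ℝ × ℝ) :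
    fderiv ℝ (fun q => fderiv ℝ g q v) p w = fderiv ℝ (fun q => fderiv ℝ g q w) p v := by
  have hd : DifferentiableAt ℝ (fderiv ℝ g) p :=
    ((hg.fderiv_of_isOpen (m := ∞) hU (by simp)).contDiffAt (hU.mem_nhds hp)).differentiableAt
      (by simp)
  have hs : IsSymmSndFDerivAt ℝ g p :=
    (hg.contDiffAt (hU.mem_nhds hp)).isSymmSndFDerivAt (by simpa using WithTop.coe_le_coe.2 (le_top : (2 : ℕ∞) ≤ ⊤))
  have e (v : ℝ × ℝ) : HasFDerivAt (fun q => fderiv ℝ g q v)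
      ((ContinuousLinearMap.apply ℝ ℝ v).comp (fderiv ℝ (fderiv ℝ g) p)) p :=
    (ContinuousLinearMap.apply ℝ ℝ v).hasFDerivAt.comp p hd.hasFDerivAt
  rw [(e v).fderiv, (e w).fderiv]
  exact hs w v

/-- The definition takes the y-derivatives first, so a further one has to be commuted past all the
x-derivatives; this is where symmetry of second derivatives enters. -/
theorem fderiv_mixedPartial_right (hU : IsOpen U) (hg : ContDiffOn ℝ ∞ g U) {p : ℝ × ℝ}
    (hp : p ∈ U) (i j : ℕ) :
    fderiv ℝ (mixedPartial g i j) p (0, 1) = mixedPartial g i (j + 1) p := by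
  induction i generalizing p with
  | zero => exact (congrFun (Function.iterate_succ_apply' (fun h p => fderiv ℝ h p (0, 1)) j g) p).symm
  | succ i ih =>
    rw [mixedPartial_succ_left, mixedPartial_succ_left,
      fderiv_fderiv_apply_comm hU (contDiffOn_mixedPartial hU hg i j) hp]
    have : (fun q => fderiv ℝ (mixedPartial g i j) q (0, 1)) =ᶠ[𝓝 p] mixedPartial g i (j + 1) := by
      filter_upwards [hU.mem_nhds hp] with q hq using ih hq
    rw [this.fderiv_eq]

/-- The total derivative of a mixed partial derivative along the graph of a function. -/
theorem hasDerivAt_mixedPartial_graph (hU : IsOpen U) (hg : ContDiffOn ℝ ∞ g U) {y : ℝ → ℝ}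
    {y' s : ℝ} (hs : (s, y s) ∈ U) (hy : HasDerivAt y y' s) (i j : ℕ) :
    HasDerivAt (fun s => mixedPartial g i j (s, y s))
      (mixedPartial g (i + 1) j (s, y s) + mixedPartial g i (j + 1) (s, y s) * y') s := by
  have hd : DifferentiableAt ℝ (mixedPartial g i j) (s, y s) :=
    ((contDiffOn_mixedPartial hU hg i j).contDiffAt (hU.mem_nhds hs)).differentiableAt (by simp)
  have h := hd.hasFDerivAt.comp_hasDerivAt s ((hasDerivAt_id s).prodMk hy)
  refine h.congr_deriv ?_
  rw [mixedPartial_succ_left, ← fderiv_mixedPartial_right hU hg hs]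
  have : ((1 : ℝ), y') = (1, 0) + y' • ((0 : ℝ), (1 : ℝ)) := by simp
  rw [this, map_add, map_smul, smul_eq_mul, mul_comm y']

theorem hasDerivAt_mixedPartial_fst (hU : IsOpen U) (hg : ContDiffOn ℝ ∞ g U) {p : ℝ × ℝ}
    (hp : p ∈ U) (i j : ℕ) :
    HasDerivAt (fun s => mixedPartial g i j (s, p.2)) (mixedPartial g (i + 1) j p) p.1 := by
  simpa using hasDerivAt_mixedPartial_graph hU hg (y := fun _ => p.2) hp (hasDerivAt_const _ _) i j

theorem hasDerivAt_mixedPartial_snd (hU : IsOpen U) (hg : ContDiffOn ℝ ∞ g U) {p : ℝ × ℝ}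
    (hp : p ∈ U) (i j : ℕ) :
    HasDerivAt (fun s => mixedPartial g i j (p.1, s)) (mixedPartial g i (j + 1) p) p.2 := by
  have hd : DifferentiableAt ℝ (mixedPartial g i j) (p.1, p.2) :=
    ((contDiffOn_mixedPartial hU hg i j).contDiffAt (hU.mem_nhds hp)).differentiableAt (by simp)
  have h := hd.hasFDerivAt.comp_hasDerivAt p.2 ((hasDerivAt_const p.2 p.1).prodMk (hasDerivAt_id p.2))
  exact h.congr_deriv (fderiv_mixedPartial_right hU hg hp i j)

end MixedPartial

/-- First total derivative of `g` along a graph with the given derivatives. -/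
noncomputable def totalDeriv₁ (g : ℝ × ℝ → ℝ) (p : ℝ × ℝ) (y₁ : ℝ) : ℝ :=
  mixedPartial g 1 0 p + mixedPartial g 0 1 p * y₁

/-- Second total derivative of `g` along a graph with the given derivatives. -/
noncomputable def totalDeriv₂ (g : ℝ × ℝ → ℝ) (p : ℝ × ℝ) (y₁ y₂ : ℝ) : ℝ :=
  mixedPartial g 2 0 p + 2 * mixedPartial g 1 1 p * y₁ + mixedPartial g 0 2 p * y₁ ^ 2
    + mixedPartial g 0 1 p * y₂

/-- Third total derivative of `g` along a graph with the given derivatives. -/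
noncomputable def totalDeriv₃ (g : ℝ × ℝ → ℝ) (p : ℝ × ℝ) (y₁ y₂ y₃ : ℝ) : ℝ :=
  mixedPartial g 3 0 p + 3 * mixedPartial g 2 1 p * y₁ + 3 * mixedPartial g 1 2 p * y₁ ^ 2
    + mixedPartial g 0 3 p * y₁ ^ 3
    + 3 * (mixedPartial g 1 1 p + mixedPartial g 0 2 p * y₁) * y₂ + mixedPartial g 0 1 p * y₃

/-- Fourth total derivative of `g` along a graph with the given derivatives. -/
noncomputable def totalDeriv₄ (g : ℝ × ℝ → ℝ) (p : ℝ × ℝ) (y₁ y₂ y₃ y₄ : ℝ) : ℝ :=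
  mixedPartial g 4 0 p + 4 * mixedPartial g 3 1 p * y₁ + 6 * mixedPartial g 2 2 p * y₁ ^ 2
    + 4 * mixedPartial g 1 3 p * y₁ ^ 3 + mixedPartial g 0 4 p * y₁ ^ 4
    + 6 * (mixedPartial g 2 1 p + 2 * mixedPartial g 1 2 p * y₁ + mixedPartial g 0 3 p * y₁ ^ 2) * y₂
    + 3 * mixedPartial g 0 2 p * y₂ ^ 2
    + 4 * (mixedPartial g 1 1 p + mixedPartial g 0 2 p * y₁) * y₃ + mixedPartial g 0 1 p * y₄

theorem HasJets.graph {g : ℝ × ℝ → ℝ} {U : Set (ℝ × ℝ)} (hU : IsOpen U) (hg : ContDiffOn ℝ ∞ g U)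
    {y y₁ y₂ y₃ y₄ : ℝ → ℝ} {x : ℝ} (hx : (x, y x) ∈ U) (hy : HasJets y y₁ y₂ y₃ y₄ x) :
    HasJets (fun s => g (s, y s)) (fun s => totalDeriv₁ g (s, y s) (y₁ s))
      (fun s => totalDeriv₂ g (s, y s) (y₁ s) (y₂ s))
      (fun s => totalDeriv₃ g (s, y s) (y₁ s) (y₂ s) (y₃ s))
      (fun s => totalDeriv₄ g (s, y s) (y₁ s) (y₂ s) (y₃ s) (y₄ s)) x := by
  have hm : ∀ᶠ s in 𝓝 x, (s, y s) ∈ U :=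
    (continuousAt_id.prodMk hy.one.self_of_nhds.continuousAt).eventually (hU.mem_nhds hx)
  have key : ∀ᶠ s in 𝓝 x, ∀ i j, HasDerivAt (fun s => mixedPartial g i j (s, y s))
      (mixedPartial g (i + 1) j (s, y s) + mixedPartial g i (j + 1) (s, y s) * y₁ s) s := by
    filter_upwards [hm, hy.one] with s hs h using hasDerivAt_mixedPartial_graph hU hg hs h
  constructor
  · filter_upwards [key] with s k
    exact k 0 0
  · filter_upwards [key, hy.two] with s k a
    refine ((k 1 0).add ((k 0 1).mul a)).congr_deriv ?_
    simp only [totalDeriv₂]; ring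
  · filter_upwards [key, hy.two, hy.three] with s k a b
    refine ((((k 2 0).add (((k 1 1).const_mul 2).mul a)).add
      ((k 0 2).mul (a.fun_pow 2))).add ((k 0 1).mul b)).congr_deriv ?_
    simp only [totalDeriv₃]; push_cast; ring
  · filter_upwards [key, hy.two, hy.three, hy.four] with s k a b c
    refine ((((((k 3 0).add (((k 2 1).const_mul 3).mul a)).add
      (((k 1 2).const_mul 3).mul (a.fun_pow 2))).add ((k 0 3).mul (a.fun_pow 3))).add
      ((((k 1 1).fun_add ((k 0 2).fun_mul a)).const_mul 3).mul b)).add ((k 0 1).mul c)).congr_deriv ?_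
    simp only [totalDeriv₄]; push_cast; ring

/-- The Taylor polynomial realises any jet, so a condition on all functions becomes a condition on
free real numbers. -/
theorem exists_contDiff_hasJets (x y y₁ y₂ y₃ y₄ : ℝ) :
    ∃ f f₁ f₂ f₃ f₄ : ℝ → ℝ, ContDiff ℝ ∞ f ∧ HasJets f f₁ f₂ f₃ f₄ x ∧
      f x = y ∧ f₁ x = y₁ ∧ f₂ x = y₂ ∧ f₃ x = y₃ ∧ f₄ x = y₄ := by
  have e (s : ℝ) : HasDerivAt (fun s => s - x) 1 s := (hasDerivAt_id s).sub_const x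
  refine ⟨fun s => y + y₁ * (s - x) + y₂ / 2 * (s - x) ^ 2 + y₃ / 6 * (s - x) ^ 3
      + y₄ / 24 * (s - x) ^ 4,
    fun s => y₁ + y₂ * (s - x) + y₃ / 2 * (s - x) ^ 2 + y₄ / 6 * (s - x) ^ 3,
    fun s => y₂ + y₃ * (s - x) + y₄ / 2 * (s - x) ^ 2, fun s => y₃ + y₄ * (s - x), fun _ => y₄,
    by fun_prop, ⟨.of_forall fun s => ?_, .of_forall fun s => ?_, .of_forall fun s => ?_,
      .of_forall fun s => ?_⟩, by simp, by simp, by simp, by simp, rfl⟩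
  · refine (((((e s).const_mul y₁).const_add y).add (((e s).pow 2).const_mul (y₂ / 2))).add
      (((e s).pow 3).const_mul (y₃ / 6))).add (((e s).pow 4).const_mul (y₄ / 24))
      |>.congr_deriv ?_
    push_cast; ring
  · refine ((((e s).const_mul y₂).const_add y₁).add (((e s).pow 2).const_mul (y₃ / 2))).add
      (((e s).pow 3).const_mul (y₄ / 6)) |>.congr_deriv ?_
    push_cast; ring
  · refine (((e s).const_mul y₃).const_add y₂).add (((e s).pow 2).const_mul (y₄ / 2))
      |>.congr_deriv ?_
    push_cast; ring
  · simpa using ((e s).const_mul y₄).const_add y₃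

/-- A point transformation acts on fourth-order jets: the derivatives of the transformed function
are determined by the chain rule, and the transformed equation holds on the transformed jet exactly
when the original one holds on the original jet. -/
theorem TransformsInto.exists_jet {φ ψ : ℝ × ℝ → ℝ} {U : Set (ℝ × ℝ)} {F G : ODE4}
    (hT : TransformsInto φ ψ U F G) (hP : IsPointTransformation φ ψ U) {p : ℝ × ℝ} (hp : p ∈ U)
    (y₁ y₂ y₃ y₄ : ℝ) (h₁ : totalDeriv₁ φ p y₁ ≠ 0) :
    ∃ u₁ u₂ u₃ u₄ : ℝ,
      totalDeriv₁ ψ p y₁ = u₁ * totalDeriv₁ φ p y₁ ∧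
      totalDeriv₂ ψ p y₁ y₂ = u₂ * totalDeriv₁ φ p y₁ ^ 2 + u₁ * totalDeriv₂ φ p y₁ y₂ ∧
      totalDeriv₃ ψ p y₁ y₂ y₃ = u₃ * totalDeriv₁ φ p y₁ ^ 3
        + 3 * u₂ * totalDeriv₁ φ p y₁ * totalDeriv₂ φ p y₁ y₂
        + u₁ * totalDeriv₃ φ p y₁ y₂ y₃ ∧
      totalDeriv₄ ψ p y₁ y₂ y₃ y₄ = u₄ * totalDeriv₁ φ p y₁ ^ 4
        + 6 * u₃ * totalDeriv₁ φ p y₁ ^ 2 * totalDeriv₂ φ p y₁ y₂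
        + u₂ * (3 * totalDeriv₂ φ p y₁ y₂ ^ 2
          + 4 * totalDeriv₁ φ p y₁ * totalDeriv₃ φ p y₁ y₂ y₃)
        + u₁ * totalDeriv₄ φ p y₁ y₂ y₃ y₄ ∧
      (F p.1 p.2 y₁ y₂ y₃ y₄ = 0 ↔ G (φ p) (ψ p) u₁ u₂ u₃ u₄ = 0) := by
  obtain ⟨x, y⟩ := p
  obtain ⟨f, f₁, f₂, f₃, f₄, hf, hJ, rfl, rfl, rfl, rfl, rfl⟩ :=
    exists_contDiff_hasJets x y y₁ y₂ y₃ y₄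
  have Jφ := HasJets.graph hP.isOpen hP.smooth_fst hp hJ
  have Jψ := HasJets.graph hP.isOpen hP.smooth_snd hp hJ
  set h : ℝ → ℝ := fun s => φ (s, f s) with hh
  have hg (g : ℝ × ℝ → ℝ) (hg : ContDiffOn ℝ ∞ g U) : ContDiffAt ℝ ∞ (fun s => g (s, f s)) x :=
    (hg.contDiffAt (hP.isOpen.mem_nhds hp)).comp x (contDiffAt_id.prodMk hf.contDiffAt)
  have hφ := hg φ hP.smooth_fst
  have hψ := hg ψ hP.smooth_snd
  have hd : HasDerivAt h (totalDeriv₁ φ (x, f x) (f₁ x)) x := Jφ.one.self_of_nhds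
  -- By `h₁`, t is a local coordinate along the graph; its local inverse `k` lets the transformed
  -- function be defined as ψ along the graph at `k t`.
  have hd' : HasFDerivAt h
      (ContinuousLinearEquiv.unitsEquivAut ℝ (Units.mk0 _ h₁) : ℝ →L[ℝ] ℝ) x := by
    refine hd.hasFDerivAt.congr_fderiv ?_
    ext; simp
  let k := hφ.localInverse hd' (by simp)
  have hk : ContDiffAt ℝ ∞ k (h x) := hφ.to_localInverse hd' (by simp)
  have hkx : k (h x) = x := hφ.localInverse_apply_image hd' (by simp)
  have hkl : ∀ᶠ s in 𝓝 x, k (h s) = s :=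
    (hφ.hasStrictFDerivAt' hd' (by simp)).eventually_left_inverse
  let u : ℝ → ℝ := fun t => ψ (k t, f (k t))
  have hu : ContDiffAt ℝ 4 u (h x) := by
    refine ContDiffAt.of_le (n := ∞) ?_ (WithTop.coe_le_coe.2 (le_top : (4 : ℕ∞) ≤ ⊤))
    exact ContDiffAt.comp (g := fun s => ψ (s, f s)) (h x) (by rw [hkx]; exact hψ) hk
  have heq : ∀ᶠ s in 𝓝 x, u (h s) = ψ (s, f s) := by
    filter_upwards [hkl] with s hs
    simp only [u, hs]
  have hi := hT f u x hp (hf.contDiffAt.of_le (WithTop.coe_le_coe.2 (le_top : (4 : ℕ∞) ≤ ⊤))) (hd.deriv ▸ h₁) hu heq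
  have Ju := hu.hasJets
  obtain ⟨e1, e2, e3, e4⟩ := Jψ.unique ((HasJets.comp (f := h) Ju Jφ).congr
    (heq.mono fun _ h => h.symm))
  refine ⟨_, _, _, _, e1, e2, e3, e4, ?_⟩
  rw [← hJ.holdsAt_iff F, hi, ODE4.HoldsAt, heq.self_of_nhds]

/-! ### Necessary conditions. -/

section Necessity

variable {α β γ μ ν κ D : ℝ} {φ ψ : ℝ × ℝ → ℝ} {U : Set (ℝ × ℝ)} {a b : ℝ → ℝ}

theorem IsPointTransformation.mono (h : IsPointTransformation φ ψ U) {V : Set (ℝ × ℝ)}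
    (hV : IsOpen V) (hVU : V ⊆ U) : IsPointTransformation φ ψ V where
  isOpen := hV
  smooth_fst := h.smooth_fst.mono hVU
  smooth_snd := h.smooth_snd.mono hVU
  injOn := h.injOn.mono hVU
  jacobian_ne_zero p hp := h.jacobian_ne_zero p (hVU hp)

theorem IsPointTransformation.jacobian_mixedPartial_ne_zero (h : IsPointTransformation φ ψ U)
    {p : ℝ × ℝ} (hp : p ∈ U) :
    mixedPartial φ 1 0 p * mixedPartial ψ 0 1 p - mixedPartial φ 0 1 p * mixedPartial ψ 1 0 p ≠ 0 :=
  h.jacobian_ne_zero p hp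

theorem mixedPartial_eq_zero_of_vanishing {g : ℝ × ℝ → ℝ} (hU : IsOpen U)
    (hg : ContDiffOn ℝ ∞ g U) {i j : ℕ} (h0 : ∀ p ∈ U, mixedPartial g i j p = 0) :
    ∀ p ∈ U, mixedPartial g (i + 1) j p = 0 ∧ mixedPartial g i (j + 1) p = 0 := by
  intro p hp
  have e : mixedPartial g i j =ᶠ[𝓝 p] fun _ => 0 := by
    filter_upwards [hU.mem_nhds hp] with q hq using h0 q hq
  rw [mixedPartial_succ_left, ← fderiv_mixedPartial_right hU hg hp]
  simp [e.fderiv_eq]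

/-- The fourth-order jet of a solution of the travelling-wave equation satisfies the linear
equation, with the derivatives of the new variables eliminated. -/
theorem TransformsInto.jet_identity
    (hT : TransformsInto φ ψ U (waveODE α β γ μ ν κ D) (linearODE a b))
    (hP : IsPointTransformation φ ψ U) {p : ℝ × ℝ} (hp : p ∈ U) (y₁ y₂ y₃ y₄ : ℝ)
    (h₁ : totalDeriv₁ φ p y₁ ≠ 0) (hF : waveODE α β γ μ ν κ D p.1 p.2 y₁ y₂ y₃ y₄ = 0) :
    totalDeriv₁ φ p y₁ ^ 2 * totalDeriv₄ ψ p y₁ y₂ y₃ y₄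
      - 6 * totalDeriv₁ φ p y₁ * totalDeriv₂ φ p y₁ y₂ * totalDeriv₃ ψ p y₁ y₂ y₃
      - (4 * totalDeriv₁ φ p y₁ * totalDeriv₃ φ p y₁ y₂ y₃ - 15 * totalDeriv₂ φ p y₁ y₂ ^ 2)
        * totalDeriv₂ ψ p y₁ y₂
      - totalDeriv₁ ψ p y₁ / totalDeriv₁ φ p y₁
        * (totalDeriv₁ φ p y₁ ^ 2 * totalDeriv₄ φ p y₁ y₂ y₃ y₄
          - 10 * totalDeriv₁ φ p y₁ * totalDeriv₂ φ p y₁ y₂ * totalDeriv₃ φ p y₁ y₂ y₃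
          + 15 * totalDeriv₂ φ p y₁ y₂ ^ 3)
      + totalDeriv₁ φ p y₁ ^ 6
        * (a (φ p) * (totalDeriv₁ ψ p y₁ / totalDeriv₁ φ p y₁) + b (φ p) * ψ p) = 0 := by
  obtain ⟨u₁, u₂, u₃, u₄, e1, e2, e3, e4, hi⟩ := hT.exists_jet hP hp y₁ y₂ y₃ y₄ h₁
  have hG := hi.1 hF
  simp only [linearODE] at hG
  rw [← div_eq_iff h₁] at e1
  rw [e1, e2, e3, e4]
  linear_combination totalDeriv₁ φ p y₁ ^ 6 * hG

/-- Solving for y'''' makes y', y'', y''' independent variables in the jet identity. -/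
theorem waveODE_eq_zero_of_leadingCoeff_ne_zero {y : ℝ} (hf : ν * y + μ * D ^ 2 ≠ 0)
    (x y₁ y₂ y₃ : ℝ) :
    waveODE α β γ μ ν κ D x y y₁ y₂ y₃
      (-(α * y₁ * y₃ + β * y₂ ^ 2 + (2 * γ * y + κ - D ^ 2) * y₂ + 2 * γ * y₁ ^ 2)
        / (ν * y + μ * D ^ 2)) = 0 := by
  simp only [waveODE]
  field_simp
  ring

/-- A point transformation linearizing the travelling-wave equation is fibre-preserving. -/
theorem TransformsInto.mixedPartial_snd_eq_zero
    (hT : TransformsInto φ ψ U (waveODE α β γ μ ν κ D) (linearODE a b))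
    (hP : IsPointTransformation φ ψ U) (hf : ∀ p ∈ U, ν * p.2 + μ * D ^ 2 ≠ 0) :
    ∀ p ∈ U, mixedPartial φ 0 1 p = 0 := by
  intro p hp
  have hJ := hP.jacobian_mixedPartial_ne_zero hp
  obtain ⟨y₁, h₁⟩ : ∃ y₁, totalDeriv₁ φ p y₁ ≠ 0 := by
    by_contra! h
    have h0 := h 0
    have h1 := h 1
    simp only [totalDeriv₁, mul_zero, add_zero, mul_one] at h0 h1
    rw [h0, zero_add] at h1
    simp [h0, h1] at hJ
  have key (y₂ y₃ : ℝ) := hT.jet_identity hP hp y₁ y₂ y₃ _ h₁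
    (waveODE_eq_zero_of_leadingCoeff_ne_zero (hf p hp) p.1 y₁ y₂ y₃)
  have k00 := key 0 0
  have k01 := key 0 1
  have k10 := key 1 0
  have k11 := key 1 1
  set A := totalDeriv₁ φ p y₁ with hA
  set c := totalDeriv₁ ψ p y₁ / A with hc
  have hcA : c * A = totalDeriv₁ ψ p y₁ := div_mul_cancel₀ _ h₁
  -- The mixed second difference in (y'', y''') isolates the coefficient of y'' y'''; the value of
  -- y'''' has no such term.
  have hn : A * mixedPartial φ 0 1 p * (mixedPartial ψ 0 1 p - c * mixedPartial φ 0 1 p) = 0 := by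
    simp only [totalDeriv₂, totalDeriv₃, totalDeriv₄] at k00 k01 k10 k11
    linear_combination (-1 / 10) * (k11 - k10 - k01 + k00)
  -- Up to the elimination of `c`, this factor is the Jacobian.
  have hJ' : A * (mixedPartial ψ 0 1 p - c * mixedPartial φ 0 1 p) ≠ 0 := by
    have : A * (mixedPartial ψ 0 1 p - c * mixedPartial φ 0 1 p) = mixedPartial φ 1 0 p *
        mixedPartial ψ 0 1 p - mixedPartial φ 0 1 p * mixedPartial ψ 1 0 p := by
      simp only [totalDeriv₁] at hA hcA
      linear_combination mixedPartial ψ 0 1 p * hA - mixedPartial φ 0 1 p * hcA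
    rwa [this]
  refine (mul_eq_zero.1 ?_).resolve_right hJ'
  linear_combination hn

/-- With φ_y = 0 the jet identity is polynomial in y', y'', y'''. Finite differences extract its
coefficients: y' y''', y''², y'² y'' and y'', in this order. The last relation is the sum of the y'²
and y'⁴ coefficients, hence its ψ_yyyy term. -/
theorem linearization_constraints
    (hT : TransformsInto φ ψ U (waveODE α β γ μ ν κ D) (linearODE a b))
    (hP : IsPointTransformation φ ψ U) (hf : ∀ p ∈ U, ν * p.2 + μ * D ^ 2 ≠ 0)
    {p : ℝ × ℝ} (hp : p ∈ U) :
    mixedPartial φ 1 0 p ≠ 0 ∧ mixedPartial ψ 0 1 p ≠ 0 ∧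
    4 * mixedPartial ψ 0 2 p * (ν * p.2 + μ * D ^ 2) = α * mixedPartial ψ 0 1 p ∧
    3 * mixedPartial ψ 0 2 p * (ν * p.2 + μ * D ^ 2) = β * mixedPartial ψ 0 1 p ∧
    mixedPartial ψ 0 3 p = 0 ∧
    (ν * p.2 + μ * D ^ 2) * (6 * mixedPartial φ 1 0 p ^ 2 * mixedPartial ψ 2 1 p
        - 18 * mixedPartial φ 1 0 p * mixedPartial φ 2 0 p * mixedPartial ψ 1 1 p
        + (15 * mixedPartial φ 2 0 p ^ 2 - 4 * mixedPartial φ 1 0 p * mixedPartial φ 3 0 p)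
          * mixedPartial ψ 0 1 p)
      = mixedPartial φ 1 0 p ^ 2 * mixedPartial ψ 0 1 p * (2 * γ * p.2 + κ - D ^ 2) ∧
    (ν * p.2 + μ * D ^ 2) * (6 * mixedPartial φ 1 0 p ^ 2 * mixedPartial ψ 2 2 p
        - 18 * mixedPartial φ 1 0 p * mixedPartial φ 2 0 p * mixedPartial ψ 1 2 p
        + (15 * mixedPartial φ 2 0 p ^ 2 - 4 * mixedPartial φ 1 0 p * mixedPartial φ 3 0 p)
          * mixedPartial ψ 0 2 p + mixedPartial φ 1 0 p ^ 2 * mixedPartial ψ 0 4 p)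
      = mixedPartial φ 1 0 p ^ 2 * mixedPartial ψ 0 1 p * (2 * γ) := by
  have v01 := hT.mixedPartial_snd_eq_zero hP hf
  have V {i j : ℕ} (h) := mixedPartial_eq_zero_of_vanishing (i := i) (j := j)
    hP.isOpen hP.smooth_fst h
  have v11 := fun q hq => (V v01 q hq).1
  have v02 := fun q hq => (V v01 q hq).2
  have v21 := fun q hq => (V v11 q hq).1
  have v12 := fun q hq => (V v11 q hq).2
  have v03 := fun q hq => (V v02 q hq).2
  have v31 := fun q hq => (V v21 q hq).1
  have v22 := fun q hq => (V v21 q hq).2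
  have v13 := fun q hq => (V v12 q hq).2
  have v04 := fun q hq => (V v03 q hq).2
  have hJ := hP.jacobian_mixedPartial_ne_zero hp
  have hfp := hf p hp
  rw [v01 p hp, zero_mul, sub_zero] at hJ
  have hA : mixedPartial φ 1 0 p ≠ 0 := left_ne_zero_of_mul hJ
  have key (y₁ y₂ y₃ : ℝ) := hT.jet_identity hP hp y₁ y₂ y₃ _
    (by simpa [totalDeriv₁, v01 p hp] using hA)
    (waveODE_eq_zero_of_leadingCoeff_ne_zero hfp p.1 y₁ y₂ y₃)
  simp only [totalDeriv₁, totalDeriv₂, totalDeriv₃, totalDeriv₄, v01 p hp, v11 p hp, v02 p hp,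
    v21 p hp, v12 p hp, v03 p hp, v31 p hp, v22 p hp, v13 p hp, v04 p hp, zero_mul, mul_zero,
    add_zero] at key
  set A := mixedPartial φ 1 0 p
  set f := ν * p.2 + μ * D ^ 2
  have hA2 : A ^ 2 ≠ 0 := pow_ne_zero 2 hA
  have hff : f / f = 1 := div_self hfp
  refine ⟨hA, right_ne_zero_of_mul hJ, ?_, ?_, ?_, ?_, ?_⟩
  · refine mul_left_cancel₀ hA2 ?_
    linear_combination f * (key 1 0 1 - key 1 0 0 - key 0 0 1 + key 0 0 0)
      + A ^ 2 * mixedPartial ψ 0 1 p * α * hff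
  · refine mul_left_cancel₀ hA2 ?_
    linear_combination f / 2 * (key 0 1 0 + key 0 (-1) 0 - 2 * key 0 0 0)
      + A ^ 2 * mixedPartial ψ 0 1 p * β * hff
  · refine (mul_eq_zero.1 (?_ : A ^ 2 * _ = 0)).resolve_left hA2
    linear_combination (1 / 12) * (key 1 1 0 - key 1 0 0 + key (-1) 1 0 - key (-1) 0 0
      - 2 * (key 0 1 0 - key 0 0 0))
  · linear_combination f / 2 * (key 0 1 0 - key 0 (-1) 0)
      + A ^ 2 * mixedPartial ψ 0 1 p * (2 * γ * p.2 + κ - D ^ 2) * hff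
  · linear_combination f / 2 * (key 1 0 0 + key (-1) 0 0 - 2 * key 0 0 0)
      + A ^ 2 * mixedPartial ψ 0 1 p * (2 * γ) * hff

theorem HasDerivAt.eq_of_eventually_eq {g h : ℝ → ℝ} {g' h' x : ℝ} (hg : HasDerivAt g g' x)
    (hh : HasDerivAt h h' x) (e : ∀ᶠ s in 𝓝 x, g s = h s) : g' = h' :=
  hg.unique (hh.congr_of_eventuallyEq e)

/-- The necessary conditions for linearizability of the travelling-wave equation. -/
theorem LinearizableAt.exists_parameter {x₀ y₀ : ℝ}
    (h : LinearizableAt (waveODE α β γ μ ν κ D) x₀ y₀) (hf₀ : ν * y₀ + μ * D ^ 2 ≠ 0) :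
    ∃ k : ℝ, α = 4 * k ∧ β = 3 * k ∧ k * (ν - k) = 0 ∧
      k * (2 * γ * y₀ + κ - D ^ 2) = 2 * γ * (ν * y₀ + μ * D ^ 2) ∧
      (k - ν) * (2 * γ * y₀ + κ - D ^ 2) = 0 := by
  obtain ⟨U, φ, ψ, a, b, hmem, hP', -, -, hT'⟩ := h
  -- The leading coefficient is nonzero only near the base point, so the domain is shrunk.
  set V : Set (ℝ × ℝ) := U ∩ {p | ν * p.2 + μ * D ^ 2 ≠ 0} with hVdef
  have hV : IsOpen V := hP'.isOpen.inter (isOpen_ne_fun (by fun_prop) (by fun_prop))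
  have hP := hP'.mono hV Set.inter_subset_left
  have hT : TransformsInto φ ψ V (waveODE α β γ μ ν κ D) (linearODE a b) :=
    fun y u x hx => hT' y u x hx.1
  have hf : ∀ p ∈ V, ν * p.2 + μ * D ^ 2 ≠ 0 := fun p hp => hp.2
  have hp : (x₀, y₀) ∈ V := ⟨hmem, hf₀⟩
  have C := fun p hp => linearization_constraints hT hP hf (p := p) hp
  have v01 := hT.mixedPartial_snd_eq_zero hP hf
  have Vφ {i j : ℕ} (h) := mixedPartial_eq_zero_of_vanishing (i := i) (j := j)
    hV hP.smooth_fst h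
  have v11 := fun q hq => (Vφ v01 q hq).1
  have v21 := fun q hq => (Vφ v11 q hq).1
  have v31 := fun q hq => (Vφ v21 q hq).1
  have w04 := (mixedPartial_eq_zero_of_vanishing hV hP.smooth_snd (i := 0) (j := 3)
    fun q hq => (C q hq).2.2.2.2.1) _ hp
  have hy : ∀ᶠ s in 𝓝 y₀, (x₀, s) ∈ V :=
    (continuousAt_const.prodMk continuousAt_id).eventually (hV.mem_nhds hp)
  obtain ⟨hA, hψ, c1, c2, c3, c4, c5⟩ := C _ hp
  obtain ⟨k, rfl⟩ : ∃ k, α = 4 * k := ⟨α / 4, by ring⟩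
  have R0 : ∀ q ∈ V, mixedPartial ψ 0 2 q * (ν * q.2 + μ * D ^ 2) = k * mixedPartial ψ 0 1 q :=
    fun q hq => by linear_combination (1 / 4) * (C q hq).2.2.1
  -- The factor ν y + μ D² is independent of x, so the relation survives differentiation in x.
  have step {i : ℕ} (h : ∀ q ∈ V, mixedPartial ψ i 2 q * (ν * q.2 + μ * D ^ 2)
      = k * mixedPartial ψ i 1 q) : ∀ q ∈ V, mixedPartial ψ (i + 1) 2 q * (ν * q.2 + μ * D ^ 2)
      = k * mixedPartial ψ (i + 1) 1 q := by
    intro q hq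
    have hx : ∀ᶠ s in 𝓝 q.1, (s, q.2) ∈ V :=
      (continuousAt_id.prodMk continuousAt_const).eventually (hV.mem_nhds hq)
    exact ((hasDerivAt_mixedPartial_fst hV hP.smooth_snd hq i 2).mul_const _).eq_of_eventually_eq
      ((hasDerivAt_mixedPartial_fst hV hP.smooth_snd hq i 1).const_mul k)
      (by filter_upwards [hx] with s hs using h _ hs)
  have R1 := step R0
  have R2 := step R1
  have dl : HasDerivAt (fun s => ν * s + μ * D ^ 2) ν y₀ := by
    simpa using ((hasDerivAt_id y₀).const_mul ν).add_const (μ * D ^ 2)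
  have dr : HasDerivAt (fun s => 2 * γ * s + κ - D ^ 2) (2 * γ) y₀ := by
    simpa using (((hasDerivAt_id y₀).const_mul (2 * γ)).add_const κ).sub_const (D ^ 2)
  have dφ (i : ℕ) := hasDerivAt_mixedPartial_snd hV hP.smooth_fst hp i 0
  have dψ (i j : ℕ) := hasDerivAt_mixedPartial_snd hV hP.smooth_snd hp i j
  -- The y-derivative of `R0`; as ψ_yyy = 0 it reads ν ψ_yy = k ψ_yy.
  have Y1 := ((dψ 0 2).mul dl).eq_of_eventually_eq ((dψ 0 1).const_mul k)
    (by filter_upwards [hy] with s hs using R0 _ hs)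
  -- The y-derivative of the y'' relation, to be compared with the independent y'² relation `c5`.
  have Y2 := (dl.fun_mul (((((dφ 1).fun_pow 2).const_mul 6).fun_mul (dψ 2 1)).fun_sub
    ((((dφ 1).const_mul 18).fun_mul (dφ 2)).fun_mul (dψ 1 1)) |>.fun_add
    (((((dφ 2).fun_pow 2).const_mul 15).fun_sub
      (((dφ 1).const_mul 4).fun_mul (dφ 3))).fun_mul (dψ 0 1)))).eq_of_eventually_eq
    ((((dφ 1).fun_pow 2).fun_mul (dψ 0 1)).fun_mul dr)
    (by filter_upwards [hy] with s hs using (C _ hs).2.2.2.2.2.1)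
  simp only [v11 _ hp, v21 _ hp, v31 _ hp, w04.2, c3] at Y1 Y2 c5
  have r0 := R0 _ hp
  have r1 := R1 _ hp
  have r2 := R2 _ hp
  simp only at r0 r1 r2 c1 c2 c4 c5
  refine ⟨k, rfl, ?_, ?_, ?_, ?_⟩
  · refine mul_right_cancel₀ hψ ?_
    linear_combination 3 * r0 - c2
  · refine mul_right_cancel₀ hψ ?_
    linear_combination (ν * y₀ + μ * D ^ 2) * Y1 - (ν - k) * r0
  · refine mul_left_cancel₀ (mul_ne_zero (pow_ne_zero 2 hA) hψ) ?_
    -- `r0`, `r1`, `r2` turn f times the bracket of `c5` into k times the bracket of `c4`.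
    linear_combination (ν * y₀ + μ * D ^ 2) * c5 - k * c4 - (ν * y₀ + μ * D ^ 2)
      * (6 * mixedPartial φ 1 0 (x₀, y₀) ^ 2 * r2
        - 18 * mixedPartial φ 1 0 (x₀, y₀) * mixedPartial φ 2 0 (x₀, y₀) * r1
        + (15 * mixedPartial φ 2 0 (x₀, y₀) ^ 2
          - 4 * mixedPartial φ 1 0 (x₀, y₀) * mixedPartial φ 3 0 (x₀, y₀)) * r0)
  · refine mul_left_cancel₀ (mul_ne_zero (pow_ne_zero 2 hA) hψ) ?_
    linear_combination -(ν * y₀ + μ * D ^ 2) * Y2 + (ν * y₀ + μ * D ^ 2) * c5 + ν * c4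
      - mixedPartial φ 1 0 (x₀, y₀) ^ 2 * (2 * γ * y₀ + κ - D ^ 2) * r0

end Necessity

/-! ### Linearizing transformations. -/

section Sufficiency

/-- The solutions of `s'' + q s = 0` with the initial data of cosine and sine at `x₀`. -/
theorem exists_generalized_cos_sin (q x₀ : ℝ) :
    ∃ C S : ℝ → ℝ, ContDiff ℝ ∞ C ∧ ContDiff ℝ ∞ S ∧ (∀ s, HasDerivAt C (-(q * S s)) s) ∧
      (∀ s, HasDerivAt S (C s) s) ∧ (∀ s, C s ^ 2 + q * S s ^ 2 = 1) ∧ C x₀ = 1 := by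
  rcases lt_trichotomy q 0 with hq | rfl | hq
  · obtain ⟨r, hr, rfl⟩ : ∃ r : ℝ, r ≠ 0 ∧ q = -r ^ 2 :=
      ⟨√(-q), (Real.sqrt_pos.2 (by linarith)).ne', by rw [Real.sq_sqrt (by linarith)]; ring⟩
    have e (s : ℝ) : HasDerivAt (fun s => r * (s - x₀)) r s := by
      simpa using ((hasDerivAt_id s).sub_const x₀).const_mul r
    refine ⟨fun s => Real.cosh (r * (s - x₀)), fun s => Real.sinh (r * (s - x₀)) / r,
      Real.contDiff_cosh.comp (by fun_prop), (Real.contDiff_sinh.comp (by fun_prop)).div_const _,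
      fun s => (e s).cosh.congr_deriv (by field_simp),
      fun s => ((e s).sinh.div_const r).congr_deriv (by field_simp), fun s => ?_, by simp⟩
    field_simp
    linear_combination Real.cosh_sq (r * (s - x₀))
  · exact ⟨fun _ => 1, fun s => s, contDiff_const, contDiff_id,
      fun s => by simpa using hasDerivAt_const s (1 : ℝ), fun s => hasDerivAt_id s, by simp, rfl⟩
  · obtain ⟨r, hr, rfl⟩ : ∃ r : ℝ, r ≠ 0 ∧ q = r ^ 2 :=
      ⟨√q, (Real.sqrt_pos.2 hq).ne', (Real.sq_sqrt hq.le).symm⟩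
    have e (s : ℝ) : HasDerivAt (fun s => r * (s - x₀)) r s := by
      simpa using ((hasDerivAt_id s).sub_const x₀).const_mul r
    refine ⟨fun s => Real.cos (r * (s - x₀)), fun s => Real.sin (r * (s - x₀)) / r,
      Real.contDiff_cos.comp (by fun_prop), (Real.contDiff_sin.comp (by fun_prop)).div_const _,
      fun s => (e s).cos.congr_deriv (by field_simp),
      fun s => ((e s).sin.div_const r).congr_deriv (by field_simp), fun s => ?_, by simp⟩
    field_simp
    linear_combination Real.sin_sq_add_cos_sq (r * (s - x₀))

/-- Derivatives of `C³ u(S / C)` for `S' = C` and `C' = -q S`. -/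
theorem HasJets.laguerreForsyth {q x : ℝ} {C S u u₁ u₂ u₃ u₄ : ℝ → ℝ}
    (hC : ∀ s, HasDerivAt C (-(q * S s)) s) (hS : ∀ s, HasDerivAt S (C s) s)
    (hCS : ∀ s, C s ^ 2 + q * S s ^ 2 = 1) (hx : C x ≠ 0)
    (hu : HasJets u u₁ u₂ u₃ u₄ (S x / C x)) :
    HasJets (fun s => C s ^ 3 * u (S s / C s))
      (fun s => -3 * q * C s ^ 2 * S s * u (S s / C s) + C s * u₁ (S s / C s))
      (fun s => (6 * q ^ 2 * C s * S s ^ 2 - 3 * q * C s ^ 3) * u (S s / C s)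
        - 4 * q * S s * u₁ (S s / C s) + (C s)⁻¹ * u₂ (S s / C s))
      (fun s => (21 * q ^ 2 * C s ^ 2 * S s - 6 * q ^ 3 * S s ^ 3) * u (S s / C s)
        + (6 * q ^ 2 * S s ^ 2 * (C s)⁻¹ - 7 * q * C s) * u₁ (S s / C s)
        - 3 * q * S s * (C s)⁻¹ ^ 2 * u₂ (S s / C s) + (C s)⁻¹ ^ 3 * u₃ (S s / C s))
      (fun s => (21 * q ^ 2 * C s ^ 3 - 60 * q ^ 3 * C s * S s ^ 2) * u (S s / C s)
        + 40 * q ^ 2 * S s * u₁ (S s / C s) - 10 * q * (C s)⁻¹ * u₂ (S s / C s)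
        + (C s)⁻¹ ^ 5 * u₄ (S s / C s)) x := by
  have hne : ∀ᶠ s in 𝓝 x, C s ≠ 0 := (hC x).continuousAt.eventually_ne hx
  -- The Wronskian-type identity `hCS` gives t' = C⁻².
  have hh (s : ℝ) (hs : C s ≠ 0) : HasDerivAt (fun s => S s / C s) ((C s)⁻¹ ^ 2) s := by
    refine ((hS s).div (hC s) hs).congr_deriv ?_
    field_simp
    linear_combination hCS s
  have hI (s : ℝ) (hs : C s ≠ 0) : HasDerivAt (fun s => (C s)⁻¹) (q * S s * (C s)⁻¹ ^ 2) s := by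
    refine ((hC s).fun_inv hs).congr_deriv ?_
    field_simp
  have hc : Filter.Tendsto (fun s => S s / C s) (𝓝 x) (𝓝 (S x / C x)) := (hh x hx).continuousAt
  have k1 : ∀ᶠ s in 𝓝 x, HasDerivAt (fun s => u (S s / C s))
      (u₁ (S s / C s) * (C s)⁻¹ ^ 2) s := by
    filter_upwards [hc.eventually hu.one, hne] with s a b using a.comp s (hh s b)
  have k2 : ∀ᶠ s in 𝓝 x, HasDerivAt (fun s => u₁ (S s / C s))
      (u₂ (S s / C s) * (C s)⁻¹ ^ 2) s := by
    filter_upwards [hc.eventually hu.two, hne] with s a b using a.comp s (hh s b)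
  have k3 : ∀ᶠ s in 𝓝 x, HasDerivAt (fun s => u₂ (S s / C s))
      (u₃ (S s / C s) * (C s)⁻¹ ^ 2) s := by
    filter_upwards [hc.eventually hu.three, hne] with s a b using a.comp s (hh s b)
  have k4 : ∀ᶠ s in 𝓝 x, HasDerivAt (fun s => u₃ (S s / C s))
      (u₄ (S s / C s) * (C s)⁻¹ ^ 2) s := by
    filter_upwards [hc.eventually hu.four, hne] with s a b using a.comp s (hh s b)
  constructor
  · filter_upwards [hne, k1] with s h a
    refine (((hC s).fun_pow 3).fun_mul a).congr_deriv ?_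
    field_simp
    ring
  · filter_upwards [hne, k1, k2] with s h a b
    refine (((((((hC s).fun_pow 2).const_mul (-3 * q)).fun_mul (hS s))).fun_mul a).fun_add
      ((hC s).fun_mul b)).congr_deriv ?_
    field_simp
    ring
  · filter_upwards [hne, k1, k2, k3] with s h a b c
    refine (((((((hC s).const_mul (6 * q ^ 2)).fun_mul ((hS s).fun_pow 2)).fun_sub
      (((hC s).fun_pow 3).const_mul (3 * q))).fun_mul a).fun_sub
      (((hS s).const_mul (4 * q)).fun_mul b)).fun_add ((hI s h).fun_mul c)).congr_deriv ?_
    field_simp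
    ring
  · filter_upwards [hne, k1, k2, k3, k4] with s h a b c d
    refine ((((((((((hC s).fun_pow 2).const_mul (21 * q ^ 2)).fun_mul (hS s)).fun_sub
      (((hS s).fun_pow 3).const_mul (6 * q ^ 3))).fun_mul a).fun_add
      ((((((hS s).fun_pow 2).const_mul (6 * q ^ 2)).fun_mul (hI s h)).fun_sub
        ((hC s).const_mul (7 * q))).fun_mul b)).fun_sub
      ((((hS s).const_mul (3 * q)).fun_mul ((hI s h).fun_pow 2)).fun_mul c)).fun_add
      (((hI s h).fun_pow 3).fun_mul d))).congr_deriv ?_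
    field_simp
    ring_nf
    field_simp
    ring

/-- An equation equivalent, near `y = y₀`, to `w'''' + 10 q w'' = 0` for the quadratic substitution
`w = m y + n y² / 2` is linearizable. -/
theorem linearizableAt_of_quadratic_substitution {F : ODE4} {m n q x₀ y₀ : ℝ}
    (h₀ : m + n * y₀ ≠ 0)
    (hF : ∀ᶠ y in 𝓝 y₀, ∀ x y₁ y₂ y₃ y₄, F x y y₁ y₂ y₃ y₄ = 0 ↔
      (m + n * y) * y₄ + 4 * n * y₁ * y₃ + 3 * n * y₂ ^ 2
        + 10 * q * ((m + n * y) * y₂ + n * y₁ ^ 2) = 0) :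
    LinearizableAt F x₀ y₀ := by
  obtain ⟨C, S, hCs, hSs, hC, hS, hCS, hC0⟩ := exists_generalized_cos_sin q x₀
  obtain ⟨δ, hδ, hball⟩ := Metric.eventually_nhds_iff_ball.1
    ((hC x₀).continuousAt.eventually_ne (hC0 ▸ one_ne_zero : C x₀ ≠ 0))
  -- All values m + n y share the sign of m + n y₀. Since 2(w - w') = (y - y')((m + n y) + (m + n
  -- y')), this gives injectivity even if `I` is not an interval.
  have hpos : ∀ᶠ y in 𝓝 y₀, 0 < (m + n * y) * (m + n * y₀) :=
    ContinuousAt.eventually_lt (f := fun _ => (0 : ℝ)) (by fun_prop) (by fun_prop)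
      (mul_self_pos.2 h₀)
  obtain ⟨I, hI, hIo, hyI⟩ := eventually_nhds_iff.1 (hF.and hpos)
  have hIne : ∀ y ∈ I, m + n * y ≠ 0 := fun y hy => left_ne_zero_of_mul (hI y hy).2.ne'
  set U : Set (ℝ × ℝ) := Metric.ball x₀ δ ×ˢ I
  have hU : IsOpen U := Metric.isOpen_ball.prod hIo
  have hCU : ∀ p ∈ U, C p.1 ≠ 0 := fun p hp => hball p.1 hp.1
  have hh (s : ℝ) (hs : C s ≠ 0) : HasDerivAt (fun s => S s / C s) ((C s)⁻¹ ^ 2) s := by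
    refine ((hS s).div (hC s) hs).congr_deriv ?_
    field_simp
    linear_combination hCS s
  have hG (y : ℝ) : HasDerivAt (fun y => m * y + n * y ^ 2 / 2) (m + n * y) y := by
    refine (((hasDerivAt_id y).const_mul m).fun_add
      ((((hasDerivAt_id y).fun_pow 2).const_mul n).div_const 2)).congr_deriv ?_
    simp; ring
  have hGJ (y : ℝ) : HasJets (fun y => m * y + n * y ^ 2 / 2) (fun y => m + n * y) (fun _ => n)
      (fun _ => 0) (fun _ => 0) y :=
    ⟨.of_forall hG, .of_forall fun s => by simpa using ((hasDerivAt_id s).const_mul n).const_add m,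
      .of_forall fun s => hasDerivAt_const s _, .of_forall fun s => hasDerivAt_const s _⟩
  have hmono : StrictMonoOn (fun s => S s / C s) (Metric.ball x₀ δ) := by
    refine strictMonoOn_of_deriv_pos (convex_ball _ _)
      (fun s hs => (hh s (hball s hs)).continuousAt.continuousWithinAt) fun s hs => ?_
    have hs' := hball s (interior_subset hs)
    rw [(hh s hs').deriv]
    positivity
  have hφ : ContDiffOn ℝ ∞ (fun p : ℝ × ℝ => S p.1 / C p.1) U :=
    ContDiffOn.div (hSs.comp contDiff_fst).contDiffOn (hCs.comp contDiff_fst).contDiffOn hCU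
  have hψ : ContDiffOn ℝ ∞ (fun p : ℝ × ℝ => (m * p.2 + n * p.2 ^ 2 / 2) / C p.1 ^ 3) U :=
    ContDiffOn.div (by fun_prop) ((hCs.comp contDiff_fst).pow 3).contDiffOn
      fun p hp => pow_ne_zero 3 (hCU p hp)
  have hb (s : ℝ) (hs : C s ≠ 0) : 1 + q * (S s / C s) ^ 2 = (C s)⁻¹ ^ 2 := by
    field_simp
    exact hCS s
  -- The leftover term is -9 q² C⁸ u, and C⁻² = 1 + q t² expresses C⁸ through t.
  refine ⟨U, fun p => S p.1 / C p.1, fun p => (m * p.2 + n * p.2 ^ 2 / 2) / C p.1 ^ 3,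
    fun _ => 0, fun t => -(9 * q ^ 2) / (1 + q * t ^ 2) ^ 4, ⟨Metric.mem_ball_self hδ, hyI⟩,
    ⟨hU, hφ, hψ, ?_, ?_⟩, contDiffOn_const, ?_, ?_⟩
  · rintro ⟨x, y⟩ hp ⟨x', y'⟩ hp' h
    simp only [Prod.mk.injEq] at h
    obtain rfl := hmono.injOn hp.1 hp'.1 h.1
    have h2 := (div_left_inj' (pow_ne_zero 3 (hCU _ hp))).1 h.2
    have hs : (m + n * y) + (m + n * y') ≠ 0 := by
      refine left_ne_zero_of_mul (b := m + n * y₀) ?_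
      have := (hI y hp.2).2
      have := (hI y' hp'.2).2
      rw [add_mul]
      positivity
    have : y - y' = 0 := (mul_eq_zero.1 (by linear_combination 2 * h2 :
      (y - y') * ((m + n * y) + (m + n * y')) = 0)).resolve_right hs
    rw [sub_eq_zero.1 this]
  · intro p hp
    have hCp := hCU p hp
    have e1 := (hasDerivAt_mixedPartial_fst hU hφ hp 0 0).unique (hh p.1 hCp)
    have e2 := (hasDerivAt_mixedPartial_snd hU hφ hp 0 0).unique (hasDerivAt_const p.2 (S p.1 / C p.1))
    have e3 := (hasDerivAt_mixedPartial_snd hU hψ hp 0 0).unique ((hG p.2).div_const (C p.1 ^ 3))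
    change mixedPartial _ 1 0 p * mixedPartial _ 0 1 p - mixedPartial _ 0 1 p * _ ≠ 0
    rw [e1, e2, e3, zero_mul, sub_zero]
    exact mul_ne_zero (pow_ne_zero 2 (inv_ne_zero hCp))
      (div_ne_zero (hIne _ hp.2) (pow_ne_zero 3 hCp))
  · refine ContDiffOn.div contDiffOn_const (by fun_prop) ?_
    rintro _ ⟨p, hp, rfl⟩
    rw [hb _ (hCU p hp)]
    exact pow_ne_zero 4 (pow_ne_zero 2 (inv_ne_zero (hCU p hp)))
  · intro y u x hx hy _ hu he
    have hCx : C x ≠ 0 := hCU _ hx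
    have Jy := hy.hasJets
    have Jw := HasJets.comp (hGJ (y x)) Jy
    have Ju := HasJets.laguerreForsyth hC hS hCS hCx hu.hasJets
    have hw : (fun s => m * y s + n * y s ^ 2 / 2) =ᶠ[𝓝 x] fun s => C s ^ 3 * u (S s / C s) := by
      filter_upwards [he, (hC x).continuousAt.eventually_ne hCx] with s hs hs'
      rw [hs]
      field_simp
    obtain ⟨-, e2, -, e4⟩ := Jw.unique (Ju.congr hw)
    rw [ODE4.HoldsAt, (hI (y x) hx.2).1, ODE4.HoldsAt, linearODE]
    have hbx : -(9 * q ^ 2) / (1 + q * (S x / C x) ^ 2) ^ 4 = -(9 * q ^ 2) * C x ^ 8 := by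
      rw [hb x hCx]
      field_simp
    simp only [hbx, zero_mul, add_zero]
    rw [← mul_eq_zero_iff_left (pow_ne_zero 5 (inv_ne_zero hCx))
      (b := iteratedDeriv 4 u (S x / C x) + _)]
    have : C x ^ 3 = (C x)⁻¹ ^ 5 * C x ^ 8 := by field_simp
    refine Eq.congr ?_ rfl
    -- In w'''' + 10 q w'' the u' and u'' terms cancel, leaving C⁻⁵ u'''' - 9 q² C³ u.
    linear_combination e4 + 10 * q * e2 - 9 * q ^ 2 * u (S x / C x) * this

end Sufficiency

/-! ### The three cases. -/

theorem eventually_leadingCoeff_ne_zero {a b y₀ : ℝ} (h : a * y₀ + b ≠ 0) :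
    ∀ᶠ y in 𝓝 y₀, a * y + b ≠ 0 :=
  ContinuousAt.eventually_ne (by fun_prop) h

/-- The travelling-wave equation `(ν H + μ D²) (H'''' + 10 q H'') = 0` is linearizable. -/
theorem linearizableAt_waveODE_of_dependent_id {γ μ ν κ D q x₀ y₀ : ℝ}
    (h : ν * y₀ + μ * D ^ 2 ≠ 0) (hγ : γ = 0) (hν : 10 * q * ν = 0)
    (hκ : κ - D ^ 2 = 10 * q * (μ * D ^ 2)) :
    LinearizableAt (waveODE 0 0 γ μ ν κ D) x₀ y₀ := by
  refine linearizableAt_of_quadratic_substitution (m := 1) (n := 0) (q := q) (by simp) ?_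
  filter_upwards [eventually_leadingCoeff_ne_zero h] with y hy x y₁ y₂ y₃ y₄
  rw [← mul_eq_zero_iff_left hy (b := _ + 10 * q * _)]
  refine Eq.congr ?_ rfl
  simp only [waveODE]
  linear_combination (2 * y * y₂ + 2 * y₁ ^ 2) * hγ - y * y₂ * hν + y₂ * hκ

/-- The travelling-wave equation `w'''' + 10 q w'' = 0` for `w = (ν H + μ D²)² / (2 ν)` is
linearizable. -/
theorem linearizableAt_waveODE_of_dependent_sq {γ μ ν κ D q x₀ y₀ : ℝ}
    (h : ν * y₀ + μ * D ^ 2 ≠ 0) (hγ : 2 * γ = 10 * q * ν)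
    (hκ : κ - D ^ 2 = 10 * q * (μ * D ^ 2)) :
    LinearizableAt (waveODE (4 * ν) (3 * ν) γ μ ν κ D) x₀ y₀ := by
  refine linearizableAt_of_quadratic_substitution (m := μ * D ^ 2) (n := ν) (q := q)
    (by rwa [add_comm]) (.of_forall fun y x y₁ y₂ y₃ y₄ => ?_)
  refine Eq.congr ?_ rfl
  simp only [waveODE]
  linear_combination (y * y₂ + y₁ ^ 2) * hγ + y₂ * hκ

theorem mainTheorem1 (α β γ μ ν κ D : ℝ) :
    (∀ (H : ℝ → ℝ) (x t : ℝ), ContDiffAt ℝ 4 H (x - D * t) →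
      (PDEHoldsAt α β γ μ ν κ (fun ξ s => H (ξ - D * s)) x t ↔
        (waveODE α β γ μ ν κ D).HoldsAt H (x - D * t))) ∧
    (∀ x₀ y₀ : ℝ, ν * y₀ + μ * D ^ 2 ≠ 0 →
      (ν = 0 →
        (LinearizableAt (waveODE α β γ μ ν κ D) x₀ y₀ ↔ α = 0 ∧ β = 0 ∧ γ = 0)) ∧
      (ν ≠ 0 → γ = 0 →
        (LinearizableAt (waveODE α β γ μ ν κ D) x₀ y₀ ↔
          (β = 0 ∧ α = 0 ∧ κ = D ^ 2) ∨ (β = 3 * ν ∧ α = 4 * ν ∧ κ = D ^ 2))) ∧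
      (ν ≠ 0 → γ ≠ 0 →
        (LinearizableAt (waveODE α β γ μ ν κ D) x₀ y₀ ↔
          α = 4 * ν ∧ β = 3 * ν ∧ κ = (2 * γ * μ + ν) * D ^ 2 / ν))) := by
  refine ⟨fun H x t hH => waveODE_holdsAt_travelling_iff hH, fun x₀ y₀ h => ⟨?_, ?_, ?_⟩⟩
  · rintro rfl
    rw [zero_mul, zero_add] at h
    constructor
    · intro hl
      obtain ⟨k, rfl, rfl, hk, hkγ, -⟩ := hl.exists_parameter (by simpa using h)
      obtain rfl : k = 0 := by simpa using hk
      simpa [h] using hkγ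
    · rintro ⟨rfl, rfl, rfl⟩
      refine linearizableAt_waveODE_of_dependent_id (q := (κ - D ^ 2) / (10 * (μ * D ^ 2)))
        (by simpa using h) rfl (by simp) ?_
      generalize μ * D ^ 2 = c at h
      field_simp
  · rintro hν rfl
    constructor
    · intro hl
      obtain ⟨k, rfl, rfl, hk, hkγ, hkν⟩ := hl.exists_parameter h
      simp only [mul_zero, zero_mul, zero_add, mul_eq_zero, sub_eq_zero] at hk hkγ hkν
      -- Since ν ≠ 0, k cannot be both 0 and ν, so κ = D².
      grind
    · rintro (⟨rfl, rfl, rfl⟩ | ⟨rfl, rfl, rfl⟩)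
      · exact linearizableAt_waveODE_of_dependent_id (q := 0) h rfl (by simp) (by simp)
      · exact linearizableAt_waveODE_of_dependent_sq (q := 0) h (by simp) (by simp)
  · intro hν hγ
    constructor
    · intro hl
      obtain ⟨k, rfl, rfl, hk, hkγ, -⟩ := hl.exists_parameter h
      have hk0 : k ≠ 0 := by
        rintro rfl
        simp [hγ, h] at hkγ
      obtain rfl : ν = k := sub_eq_zero.1 ((mul_eq_zero.1 hk).resolve_left hk0)
      refine ⟨rfl, rfl, ?_⟩
      rw [eq_div_iff hν]
      linear_combination hkγ
    · rintro ⟨rfl, rfl, rfl⟩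
      -- The value of q is forced by 2γ = 10 q ν.
      refine linearizableAt_waveODE_of_dependent_sq (q := γ / (5 * ν)) h ?_ ?_ <;>
        field_simp <;> ring
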